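/- Let $P$ be a field, $F$ the free Lie algebra over $P$ with basis (free generating set) $\{g_j : j\in J\}$, where $J$ is an arbitrary set, and let $U(F)$ be its universal enveloping algebra. For $v\in F$ let $D_j(v)\in U(F)$ $(j\in J)$ be the (Umirbaev–)Fox derivatives of $v$, that is, the unique elements of $U(F)$, almost all zero, such that $v=\sum_{j\in J} g_j D_j(v)$ in $U(F)$. Let $N$ be an ideal of $F$, let $N_U$ be the two-sided ideal of $U(F)$ generated by $N$, let $K\subseteq J$, let $F_K$ be the subalgebra of $F$ generated by $\{g_j : j\in K\}$, and let $v\in F$. Then $$D_k(v)\in N_U\quad\text{for all } k\in J\setminus K$$ if and only if there are elements $v_0\in F_K$ and $v_1$ in the ideal of $F$ generated by $F_K\cap N$ such that $$v-(v_0+v_1)\in [N,N].$$ (For $K=\emptyset$ this is Kharlampovich's theorem: $D_j(v)\in N_U$ for all $j\in J$ if and only if $v\in[N,N]$.) -/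

import Mathlib

noncomputable section

namespace FoxLie

attribute [local instance 100] LieRing.ofAssociativeRing

variable (P : Type*) [Field P] {J : Type*}

/-- The universal enveloping algebra `U(F)` of the free Lie algebra `F` on `J` over `P`. -/
abbrev U (P : Type*) [Field P] (J : Type*) : Type _ :=
  UniversalEnvelopingAlgebra P (FreeLieAlgebra P J)

/-- The canonical map of the free Lie algebra `F` into `U(F)`. -/
def toU : FreeLieAlgebra P J →ₗ[P] U P J :=
  (UniversalEnvelopingAlgebra.ι P : FreeLieAlgebra P J →ₗ⁅P⁆ U P J)

/-- The basis element `g_j`, regarded as an element of `U(F)`. -/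
def gU (j : J) : U P J := toU P (FreeLieAlgebra.of P j)

/-- The augmentation `ε : U(F) → P`, the algebra homomorphism that kills `F`. -/
def aug : U P J →ₐ[P] P :=
  UniversalEnvelopingAlgebra.lift P (0 : FreeLieAlgebra P J →ₗ⁅P⁆ P)

open Classical in
/-- The algebra homomorphism `U(F) → M₂(U(F))` with `g_j ↦ (0, δ_{jk}; 0, g_j)`. It has the form
`u ↦ (ε(u), D_k(u); 0, u)`, where `D_k(uv) = D_k(u) v + ε(u) D_k(v)`. -/
def foxMatrix (k : J) : U P J →ₐ[P] Matrix (Fin 2) (Fin 2) (U P J) :=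
  UniversalEnvelopingAlgebra.lift P
    (FreeLieAlgebra.lift P fun j => !![0, if j = k then 1 else 0; 0, gU P j])

/-- The Fox derivative `D_k : U(F) → U(F)`. By `foxD_sum` and `foxD_unique` below, for `u` with
`ε(u) = 0` (in particular for `u ∈ F`) the `D_j(u)` are the unique elements of `U(F)`, almost all
zero, such that `u = ∑_j g_j D_j(u)`. -/
def foxD (k : J) : U P J →ₗ[P] U P J where
  toFun u := foxMatrix P k u 0 1
  map_add' u v := by simp
  map_smul' a u := by simp

/-- The two-sided ideal `N_U` of `U(F)` generated by an ideal `N` of `F`. -/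
def idealU (N : LieIdeal P (FreeLieAlgebra P J)) : TwoSidedIdeal (U P J) :=
  TwoSidedIdeal.span (toU P '' (N : Set (FreeLieAlgebra P J)))

/-- The subalgebra `F_K` of `F` generated by the `g_j` with `j ∈ K`. -/
def subalg (K : Set J) : LieSubalgebra P (FreeLieAlgebra P J) :=
  LieSubalgebra.lieSpan P (FreeLieAlgebra P J) (FreeLieAlgebra.of P '' K)

/-- The ideal of `F` generated by `F_K ∩ N`. -/
def idealKN (K : Set J) (N : LieIdeal P (FreeLieAlgebra P J)) : LieIdeal P (FreeLieAlgebra P J) :=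
  LieSubmodule.lieSpan P (FreeLieAlgebra P J)
    ((subalg P K : Set (FreeLieAlgebra P J)) ∩ (N : Set (FreeLieAlgebra P J)))

theorem U_induction {p : U P J → Prop} (h1 : p 1) (hg : ∀ j u, p u → p (gU P j * u))
    (hadd : ∀ u v, p u → p v → p (u + v)) (hsmul : ∀ (a : P) u, p u → p (a • u)) (u : U P J) :
    p u := by
  let e := FreeLieAlgebra.universalEnvelopingEquivFreeAlgebra P J
  have he : ∀ j, e.symm (FreeAlgebra.ι P j) = gU P j := by
    intro j
    simp [e, gU, toU, FreeLieAlgebra.universalEnvelopingEquivFreeAlgebra]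
  have key : ∀ x : FreeAlgebra P J, ∀ u, p u → p (e.symm x * u) := by
    intro x
    induction x using FreeAlgebra.induction with
    | grade0 r =>
      intro u hu
      rw [AlgEquiv.commutes, ← Algebra.smul_def]
      exact hsmul r u hu
    | grade1 j => intro u hu; rw [he]; exact hg j u hu
    | mul a b ha hb => intro u hu; rw [map_mul, mul_assoc]; exact ha _ (hb _ hu)
    | add a b ha hb => intro u hu; rw [map_add, add_mul]; exact hadd _ _ (ha _ hu) (hb _ hu)
  simpa using key (e u) 1 h1

theorem aug_toU (v : FreeLieAlgebra P J) : aug P (toU P v) = 0 := by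
  simp [aug, toU]

open Classical in
theorem foxMatrix_gU (k j : J) :
    foxMatrix P k (gU P j) = !![0, if j = k then 1 else 0; 0, gU P j] := by
  simp [foxMatrix, gU, toU]

theorem foxMatrix_one_one (k : J) (u : U P J) : foxMatrix P k u 1 1 = u := by
  induction u using U_induction P with
  | h1 => simp
  | hg j u hu => simp [foxMatrix_gU, Matrix.mul_apply, Fin.sum_univ_two, hu]
  | hadd u v hu hv => simp [hu, hv]
  | hsmul a u hu => simp [hu]

theorem foxD_one (k : J) : foxD P k 1 = 0 := by
  simp [foxD]

open Classical in
theorem foxD_gU_mul (k j : J) (u : U P J) : foxD P k (gU P j * u) = if j = k then u else 0 := by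
  have h := foxMatrix_one_one P k u
  simp only [foxD, LinearMap.coe_mk, AddHom.coe_mk, map_mul, foxMatrix_gU, Matrix.mul_apply,
    Fin.sum_univ_two, h]
  simp

theorem foxD_unique (d : J →₀ U P J) (k : J) :
    foxD P k (d.sum fun j u => gU P j * u) = d k := by
  classical
  rw [Finsupp.sum, map_sum]
  simp only [foxD_gU_mul]
  simp [eq_comm]

theorem foxD_sum (u : U P J) : ∃ d : J →₀ U P J, (∀ j, d j = foxD P j u) ∧
    u = algebraMap P (U P J) (aug P u) + d.sum fun j w => gU P j * w := by
  classical
  suffices h : ∃ d : J →₀ U P J,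
      u = algebraMap P (U P J) (aug P u) + d.sum fun j w => gU P j * w by
    obtain ⟨d, hd⟩ := h
    refine ⟨d, fun j => ?_, hd⟩
    conv_rhs => rw [hd]
    rw [map_add, foxD_unique, Algebra.algebraMap_eq_smul_one, map_smul, foxD_one, smul_zero,
      zero_add]
  induction u using U_induction P with
  | h1 => exact ⟨0, by simp⟩
  | hg j u hu => exact ⟨Finsupp.single j u, by simp [gU, aug_toU]⟩
  | hadd u v hu hv =>
    obtain ⟨d, hd⟩ := hu
    obtain ⟨e, he⟩ := hv
    refine ⟨d + e, ?_⟩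
    rw [Finsupp.sum_add_index' (by simp) (by intros; rw [mul_add]), map_add, map_add]
    nth_rewrite 1 [hd]
    nth_rewrite 1 [he]
    abel
  | hsmul a u hu =>
    obtain ⟨d, hd⟩ := hu
    refine ⟨a • d, ?_⟩
    rw [Finsupp.sum_smul_index' (by simp)]
    nth_rewrite 1 [hd]
    simp [Finsupp.sum, Finset.smul_sum, Algebra.algebraMap_eq_smul_one, smul_smul]

end FoxLie

end

/-! If `v` has the stated form, its derivatives lie in N_U because D_k vanishes on F_K for k outside
K, and the x in N with D_k(x) in N_U form an ideal (`foxIdeal`) containing F_K ∩ N and [N,N].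

For the converse, let R be the sum of [N,N] and the ideal generated by F_K ∩ N, and put E = F/R. The
image M of N is an abelian ideal of E, and the image S of F_K meets M in 0; the claim is that v maps
into S (`map_mem_of_foxD`). Take an ordered basis of E that starts with a basis of S and ends with a
basis of M, and let E act on polynomials in the basis elements as in the Poincaré–Birkhoff–Witt
theorem. Apply v = ∑ g_j D_j(v) to the constant 1. The terms with j in K give monomials with a
variable from S (`pbwRep_mem_meetSpan_of_lower`). For j outside K, D_j(v) in N_U gives monomials
with a variable from M (`pbwRep_mem_meetSpan_of_upper`), and g_j then makes their degree at least
two, since M is abelian (`pbwRep_mem_meetSpanTwo`). But v·1 is linear, its coefficients being the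
coordinates of the image of v, so only coordinates from S survive. -/

noncomputable section

namespace FoxLie

attribute [local instance 100] LieRing.ofAssociativeRing

/-! ### The Poincaré–Birkhoff–Witt action on polynomials. -/

section PBW

variable {P : Type*} [Field P] {E : Type*} [LieRing E] [LieAlgebra P E] {I : Type*}

/-- The monomial `z_s` in the polynomial space on `I`, realised as `Multiset I →₀ P`. -/
abbrev mon (P : Type*) [Field P] {I : Type*} (s : Multiset I) : Multiset I →₀ P :=
  Finsupp.single s 1

/-- The span of the monomials `z_s` with `s ∈ A`. -/
abbrev monSpan (P : Type*) [Field P] {I : Type*} (A : Set (Multiset I)) :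
    Submodule P (Multiset I →₀ P) :=
  Finsupp.supported P P A

/-- The polynomials of degree at most `n`. -/
abbrev degLE (P : Type*) [Field P] (I : Type*) (n : ℕ) : Submodule P (Multiset I →₀ P) :=
  monSpan P {s : Multiset I | s.card ≤ n}

theorem mon_mem_monSpan {A : Set (Multiset I)} {s : Multiset I} (h : s ∈ A) :
    mon P s ∈ monSpan P A :=
  Finsupp.single_mem_supported P 1 h

theorem monSpan_induction {A : Set (Multiset I)} {p : (Multiset I →₀ P) → Prop}
    (hmon : ∀ s ∈ A, p (mon P s)) (h0 : p 0) (hadd : ∀ f g, p f → p g → p (f + g))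
    (hsmul : ∀ (a : P) f, p f → p (a • f)) {f : Multiset I →₀ P} (hf : f ∈ monSpan P A) : p f := by
  rw [monSpan, Finsupp.supported_eq_span_single] at hf
  induction hf using Submodule.span_induction with
  | mem x hx => obtain ⟨s, hs, rfl⟩ := hx; exact hmon s hs
  | zero => exact h0
  | add x y _ _ hx hy => exact hadd x y hx hy
  | smul a x _ hx => exact hsmul a x hx

theorem monSpan_le {A : Set (Multiset I)} {W : Submodule P (Multiset I →₀ P)}
    (h : ∀ s ∈ A, mon P s ∈ W) : monSpan P A ≤ W := fun _ hf =>
  monSpan_induction h W.zero_mem (fun _ _ => W.add_mem) (fun a _ => W.smul_mem a) hf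

theorem basis_induction (b : Module.Basis I P E) {p : E → Prop} (hb : ∀ i, p (b i)) (h0 : p 0)
    (hadd : ∀ x y, p x → p y → p (x + y)) (hsmul : ∀ (a : P) x, p x → p (a • x)) (x : E) : p x := by
  have hx : x ∈ Submodule.span P (Set.range b) := by simp
  induction hx using Submodule.span_induction with
  | mem x hx => obtain ⟨i, rfl⟩ := hx; exact hb i
  | zero => exact h0
  | add x y _ _ hx hy => exact hadd x y hx hy
  | smul a x _ hx => exact hsmul a x hx

theorem mem_of_basis_span {b : Module.Basis I P E} {A : Set I} {T : E →ₗ[P] Multiset I →₀ P}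
    {W : Submodule P (Multiset I →₀ P)} (h : ∀ i ∈ A, T (b i) ∈ W) {x : E}
    (hx : x ∈ Submodule.span P (b '' A)) : T x ∈ W := by
  have : Submodule.span P (b '' A) ≤ W.comap T := by
    rw [Submodule.span_le]
    rintro _ ⟨i, hi, rfl⟩
    exact h i hi
  exact this hx

/-- The bilinear map `E × V → V` with prescribed values on basis elements and monomials. -/
def bilin (b : Module.Basis I P E) (f : I → Multiset I → Multiset I →₀ P) :
    E →ₗ[P] (Multiset I →₀ P) →ₗ[P] (Multiset I →₀ P) :=
  b.constr P fun i => Finsupp.linearCombination P (f i)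

theorem bilin_basis_mon (b : Module.Basis I P E) (f : I → Multiset I → Multiset I →₀ P) (i : I)
    (s : Multiset I) : bilin b f (b i) (mon P s) = f i s := by
  simp [bilin, mon]

theorem bilin_congr (b : Module.Basis I P E) {f g : I → Multiset I → Multiset I →₀ P}
    {A : Set (Multiset I)} (h : ∀ i, ∀ s ∈ A, f i s = g i s) (x : E) {w : Multiset I →₀ P}
    (hw : w ∈ monSpan P A) : bilin b f x w = bilin b g x w := by
  refine monSpan_induction (p := fun w => bilin b f x w = bilin b g x w) (fun s hs => ?_) (by simp)
    (fun f g hf hg => by simp [hf, hg]) (fun a f hf => by simp [hf]) hw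
  · have : (bilin b f).flip (mon P s) = (bilin b g).flip (mon P s) :=
      b.ext fun i => by
        simp only [LinearMap.flip_apply]
        rw [bilin_basis_mon, bilin_basis_mon, h i s hs]
    exact LinearMap.congr_fun this x

theorem exists_min_cons [LinearOrder I] {s : Multiset I} (hs : s ≠ 0) :
    ∃ j t, s = j ::ₘ t ∧ ∀ k ∈ t, j ≤ k := by
  classical
  obtain ⟨j, hj, hmin⟩ := s.toFinset.exists_min_image id
    (by simpa [Finset.nonempty_iff_ne_empty] using hs)
  refine ⟨j, s.erase j, (Multiset.cons_erase (by simpa using hj)).symm, fun k hk => ?_⟩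
  exact hmin k (by simpa using Multiset.mem_of_mem_erase hk)

theorem le_or_exists_min_cons [LinearOrder I] (i : I) (s : Multiset I) :
    (∀ k ∈ s, i ≤ k) ∨ ∃ j t, s = j ::ₘ t ∧ (∀ k ∈ t, j ≤ k) ∧ j < i := by
  rcases eq_or_ne s 0 with rfl | hs
  · simp
  obtain ⟨j, t, rfl, hj⟩ := exists_min_cons hs
  rcases lt_or_ge j i with hji | hij
  · exact Or.inr ⟨j, t, rfl, hj, hji⟩
  · refine Or.inl fun k hk => ?_
    rcases Multiset.mem_cons.1 hk with rfl | hk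
    · exact hij
    · exact hij.trans (hj k hk)

/-- The hypothesis is needed only up to degree `n`, so this applies to the truncated action inside
the induction of `pbwVal_sub_mem`. -/
theorem bilin_mem_degLE {b : Module.Basis I P E} {f : I → Multiset I → Multiset I →₀ P} {n : ℕ}
    (hf : ∀ i (s : Multiset I), s.card ≤ n → f i s - mon P (i ::ₘ s) ∈ degLE P I s.card)
    (x : E) {m : ℕ} (hmn : m ≤ n) {w : Multiset I →₀ P} (hw : w ∈ degLE P I m) :
    bilin b f x w ∈ degLE P I (m + 1) := by
  refine monSpan_le (W := (degLE P I (m + 1)).comap (bilin b f x)) (fun s hs => ?_) hw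
  · have hs : s.card ≤ m := hs
    have : (bilin b f).flip (mon P s) x ∈ degLE P I (m + 1) := by
      refine mem_of_basis_span (b := b) (A := Set.univ) (fun i _ => ?_) (by simp)
      rw [LinearMap.flip_apply, bilin_basis_mon, ← sub_add_cancel (f i s) (mon P (i ::ₘ s))]
      refine add_mem (Finsupp.supported_mono (fun r hr => ?_) (hf i s (hs.trans hmn)))
        (mon_mem_monSpan ?_)
      · have hr : r.card ≤ s.card := hr
        show r.card ≤ m + 1
        omega
      · simpa using hs
    exact this

variable [LinearOrder I]

open Classical in
/-- The value of the Poincaré–Birkhoff–Witt action of the basis element `b i` on the monomial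
`z_s`. -/
def pbwVal (b : Module.Basis I P E) (i : I) (s : Multiset I) : Multiset I →₀ P :=
  if h : ∃ p : I × Multiset I, s = p.1 ::ₘ p.2 ∧ (∀ k ∈ p.2, p.1 ≤ k) ∧ p.1 < i then
    let j := h.choose.1
    let t := h.choose.2
    -- The rule is b_i z_{jt} = b_j (b_i z_t) + [b_i, b_j] z_t with the leading term z_{ijt} split
    -- off. What remains involves degrees at most `t.card` only, so the default 0, present for
    -- termination, is never reached.
    let g : I → Multiset I → Multiset I →₀ P := fun k r =>
      if _hr : r.card < s.card then pbwVal b k r else 0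
    mon P (i ::ₘ s) + bilin b g (b j) (g i t - mon P (i ::ₘ t)) + bilin b g ⁅b i, b j⁆ (mon P t)
  else mon P (i ::ₘ s)
termination_by s.card

theorem min_cons_unique {j j' : I} {t t' : Multiset I} (h : j ::ₘ t = j' ::ₘ t')
    (hj : ∀ k ∈ t, j ≤ k) (hj' : ∀ k ∈ t', j' ≤ k) : j = j' ∧ t = t' := by
  have h1 : j' ≤ j := by
    have : j ∈ j' ::ₘ t' := h ▸ Multiset.mem_cons_self j t
    rcases Multiset.mem_cons.1 this with h | h
    · exact h.ge
    · exact hj' _ h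
  have h2 : j ≤ j' := by
    have : j' ∈ j ::ₘ t := h ▸ Multiset.mem_cons_self j' t'
    rcases Multiset.mem_cons.1 this with h | h
    · exact h.ge
    · exact hj _ h
  obtain rfl := le_antisymm h2 h1
  exact ⟨rfl, (Multiset.cons_inj_right j).1 h⟩

theorem pbwVal_of_le (b : Module.Basis I P E) {i : I} {s : Multiset I} (h : ∀ k ∈ s, i ≤ k) :
    pbwVal b i s = mon P (i ::ₘ s) := by
  rw [pbwVal, dif_neg]
  rintro ⟨⟨j, t⟩, rfl, -, hlt⟩
  exact (h j (Multiset.mem_cons_self j t)).not_gt hlt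

/-- The Poincaré–Birkhoff–Witt action as a bilinear map. -/
def pbwAct (b : Module.Basis I P E) : E →ₗ[P] (Multiset I →₀ P) →ₗ[P] (Multiset I →₀ P) :=
  bilin b (pbwVal b)

theorem pbwAct_of_le (b : Module.Basis I P E) {i : I} {s : Multiset I} (h : ∀ k ∈ s, i ≤ k) :
    pbwAct b (b i) (mon P s) = mon P (i ::ₘ s) := by
  rw [pbwAct, bilin_basis_mon, pbwVal_of_le b h]

open Classical in
theorem pbwVal_cons_aux (b : Module.Basis I P E) {i j : I} {t : Multiset I} (hj : ∀ k ∈ t, j ≤ k)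
    (hji : j < i) {g : I → Multiset I → Multiset I →₀ P}
    (hg : g = fun k r => if r.card < t.card + 1 then pbwVal b k r else 0) :
    pbwVal b i (j ::ₘ t) = mon P (i ::ₘ j ::ₘ t) +
      bilin b g (b j) (pbwVal b i t - mon P (i ::ₘ t)) + bilin b g ⁅b i, b j⁆ (mon P t) := by
  have h : ∃ p : I × Multiset I,
    j ::ₘ t = p.1 ::ₘ p.2 ∧ (∀ k ∈ p.2, p.1 ≤ k) ∧ p.1 < i := ⟨(j, t), rfl, hj, hji⟩
  obtain ⟨h1, h2⟩ := min_cons_unique h.choose_spec.1 hj h.choose_spec.2.1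
  rw [pbwVal, dif_pos h]
  simp only [← h1, ← h2, Multiset.card_cons, dite_eq_ite]
  subst hg
  simp

theorem pbwVal_sub_mem (b : Module.Basis I P E) (i : I) (s : Multiset I) :
    pbwVal b i s - mon P (i ::ₘ s) ∈ degLE P I s.card := by
  induction hn : s.card using Nat.strong_induction_on generalizing i s with
  | _ n ih =>
  subst hn
  rcases le_or_exists_min_cons i s with hs | ⟨j, t, rfl, hj, hji⟩
  · rw [pbwVal_of_le b hs, sub_self]
    exact zero_mem _
  rw [Multiset.card_cons] at ih ⊢
  classical
  have hg : ∀ k (r : Multiset I), r.card ≤ t.card →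
      (if r.card < t.card + 1 then pbwVal b k r else 0) - mon P (k ::ₘ r) ∈ degLE P I r.card := by
    intro k r hr
    rw [if_pos (by omega)]
    exact ih r.card (by omega) k r rfl
  rw [pbwVal_cons_aux b hj hji rfl, add_assoc, add_sub_cancel_left]
  exact add_mem (bilin_mem_degLE hg _ le_rfl (ih t.card (by omega) i t rfl))
    (bilin_mem_degLE hg _ le_rfl (mon_mem_monSpan (le_refl t.card)))

theorem pbwAct_sub_mem (b : Module.Basis I P E) (i : I) (s : Multiset I) :
    pbwAct b (b i) (mon P s) - mon P (i ::ₘ s) ∈ degLE P I s.card := by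
  rw [pbwAct, bilin_basis_mon]
  exact pbwVal_sub_mem b i s

/-- This case of the commutation rule is the defining recursion itself, once the truncation is
removed by the degree bound. -/
theorem pbwAct_comm_of_le (b : Module.Basis I P E) {i j : I} {t : Multiset I}
    (hj : ∀ k ∈ t, j ≤ k) (hji : j < i) :
    pbwAct b (b i) (pbwAct b (b j) (mon P t)) =
      pbwAct b (b j) (pbwAct b (b i) (mon P t)) + pbwAct b ⁅b i, b j⁆ (mon P t) := by
  classical
  have hle : ∀ k ∈ i ::ₘ t, j ≤ k := by
    intro k hk
    rcases Multiset.mem_cons.1 hk with rfl | hk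
    · exact hji.le
    · exact hj k hk
  have hg : ∀ k, ∀ r ∈ {r : Multiset I | r.card ≤ t.card},
      (if r.card < t.card + 1 then pbwVal b k r else 0) = pbwVal b k r := by
    intro k r hr
    have hr : r.card ≤ t.card := hr
    rw [if_pos (by omega)]
  rw [pbwAct_of_le b hj]
  have hsplit : pbwAct b (b i) (mon P t) =
    mon P (i ::ₘ t) + (pbwVal b i t - mon P (i ::ₘ t)) := by
    rw [pbwAct, bilin_basis_mon]; abel
  rw [hsplit, map_add, pbwAct_of_le b hle]
  conv_lhs => rw [pbwAct, bilin_basis_mon, pbwVal_cons_aux b hj hji rfl]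
  rw [bilin_congr b hg _ (pbwVal_sub_mem b i t),
    bilin_congr b hg _ (mon_mem_monSpan (le_refl t.card)), Multiset.cons_swap]
  rfl

/-- Induction on the degree. By antisymmetry it suffices to treat b_i, b_j with j < i; if some
variable of z_s is below j, the least one is pulled out and the Jacobi identity reduces to lower
degree. -/
theorem pbwAct_lie_mon (b : Module.Basis I P E) (x y : E) (s : Multiset I) :
    pbwAct b x (pbwAct b y (mon P s)) =
      pbwAct b y (pbwAct b x (mon P s)) + pbwAct b ⁅x, y⁆ (mon P s) := by
  induction hn : s.card using Nat.strong_induction_on generalizing x y s with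
  | _ n ih =>
  subst hn
  have ih' : ∀ (x y : E) {m : ℕ}, m < s.card → ∀ {w : Multiset I →₀ P}, w ∈ degLE P I m →
      pbwAct b x (pbwAct b y w) = pbwAct b y (pbwAct b x w) + pbwAct b ⁅x, y⁆ w := by
    intro x y m hm w hw
    refine monSpan_induction
      (p := fun w => pbwAct b x (pbwAct b y w) = pbwAct b y (pbwAct b x w) + pbwAct b ⁅x, y⁆ w)
      (fun r hr => ih r.card (lt_of_le_of_lt hr hm) x y r rfl) (by simp) (fun f g hf hg => ?_)
      (fun a f hf => ?_) hw
    · simp only [map_add, hf, hg]; abel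
    · simp only [map_smul, hf, smul_add]
  have key : ∀ i j, j < i → pbwAct b (b i) (pbwAct b (b j) (mon P s)) =
      pbwAct b (b j) (pbwAct b (b i) (mon P s)) + pbwAct b ⁅b i, b j⁆ (mon P s) := by
    intro i j hji
    rcases le_or_exists_min_cons j s with hjs | ⟨k, t, rfl, hk, hkj⟩
    · exact pbwAct_comm_of_le b hjs hji
    have hkt : t.card < (k ::ₘ t).card := by simp
    have hmt : mon P t ∈ degLE P I t.card := mon_mem_monSpan (le_refl t.card)
    -- b_q z_t may have the degree of z_s, out of reach of induction. Its leading term z_{qt} is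
    -- covered by `pbwAct_comm_of_le`, the rest by induction.
    have move : ∀ p q, k < p → k < q →
        pbwAct b (b p) (pbwAct b (b k) (pbwAct b (b q) (mon P t))) =
        pbwAct b (b k) (pbwAct b (b p) (pbwAct b (b q) (mon P t))) +
          pbwAct b ⁅b p, b k⁆ (pbwAct b (b q) (mon P t)) := by
      intro p q hp hq
      have hle : ∀ l ∈ q ::ₘ t, k ≤ l := by
        intro l hl
        rcases Multiset.mem_cons.1 hl with rfl | hl
        · exact hq.le
        · exact hk l hl
      have h1 := ih' (b p) (b k) hkt (pbwAct_sub_mem b q t)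
      have h2 := pbwAct_comm_of_le b hle hp
      simp only [map_sub] at h1
      rw [sub_eq_iff_eq_add] at h1
      rw [h1, h2]
      abel
    have hswap : ∀ p, pbwAct b (b p) (pbwAct b (b k) (mon P t)) =
        pbwAct b (b k) (pbwAct b (b p) (mon P t)) + pbwAct b ⁅b p, b k⁆ (mon P t) :=
      fun p => ih' _ _ hkt hmt
    -- With z_s = b_k z_t, all operators b_k are moved to the left; the leftover brackets cancel by
    -- Jacobi (`lie_lie`).
    rw [← pbwAct_of_le b hk, hswap j, hswap i, map_add, map_add, move i j (hkj.trans hji) hkj,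
      move j i hkj (hkj.trans hji), ih' (b i) ⁅b j, b k⁆ hkt hmt, ih' (b j) ⁅b i, b k⁆ hkt hmt,
      ih' (b i) (b j) hkt hmt, ih' ⁅b i, b j⁆ (b k) hkt hmt, map_add, lie_lie (b i) (b j) (b k),
      map_sub, LinearMap.sub_apply]
    abel
  have hbasis : ∀ i j, pbwAct b (b i) (pbwAct b (b j) (mon P s)) =
      pbwAct b (b j) (pbwAct b (b i) (mon P s)) + pbwAct b ⁅b i, b j⁆ (mon P s) := by
    intro i j
    rcases lt_trichotomy i j with h | rfl | h
    · rw [key j i h, ← lie_skew (b i) (b j), map_neg, LinearMap.neg_apply]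
      abel
    · simp
    · exact key i j h
  refine basis_induction b (p := fun x => pbwAct b x (pbwAct b y (mon P s)) =
    pbwAct b y (pbwAct b x (mon P s)) + pbwAct b ⁅x, y⁆ (mon P s)) (fun i => ?_) (by simp)
    (fun x x' hx hx' => ?_) (fun a x hx => ?_) x
  · refine basis_induction b (p := fun y => pbwAct b (b i) (pbwAct b y (mon P s)) =
      pbwAct b y (pbwAct b (b i) (mon P s)) + pbwAct b ⁅b i, y⁆ (mon P s)) (hbasis i) (by simp)
      (fun y y' hy hy' => ?_) (fun a y hy => ?_) y
    · simp only [map_add, LinearMap.add_apply, lie_add, hy, hy']; abel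
    · simp only [map_smul, LinearMap.smul_apply, lie_smul, hy, smul_add]
  · simp only [map_add, LinearMap.add_apply, add_lie, hx, hx']; abel
  · simp only [map_smul, LinearMap.smul_apply, smul_lie, hx, smul_add]

/-- The Poincaré–Birkhoff–Witt module of a Lie algebra with an ordered basis. -/
def pbwRep (b : Module.Basis I P E) : E →ₗ⁅P⁆ Module.End P (Multiset I →₀ P) where
  __ := pbwAct b
  map_lie' {x y} := by
    refine Finsupp.lhom_ext' fun s => LinearMap.ext_ring ?_
    simp only [AddHom.toFun_eq_coe, LinearMap.coe_toAddHom, LieRing.of_associative_ring_bracket,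
      LinearMap.comp_apply, Finsupp.lsingle_apply, LinearMap.sub_apply, Module.End.mul_apply]
    exact eq_sub_of_add_eq' (pbwAct_lie_mon b x y s).symm

theorem pbwRep_of_le (b : Module.Basis I P E) {i : I} {s : Multiset I} (h : ∀ k ∈ s, i ≤ k) :
    pbwRep b (b i) (mon P s) = mon P (i ::ₘ s) :=
  pbwAct_of_le b h

theorem pbwRep_sub_mem (b : Module.Basis I P E) (i : I) (s : Multiset I) :
    pbwRep b (b i) (mon P s) - mon P (i ::ₘ s) ∈ degLE P I s.card :=
  pbwAct_sub_mem b i s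

theorem pbwRep_comm (b : Module.Basis I P E) (x y : E) (w : Multiset I →₀ P) :
    pbwRep b x (pbwRep b y w) = pbwRep b y (pbwRep b x w) + pbwRep b ⁅x, y⁆ w := by
  rw [LieHom.map_lie, LieRing.of_associative_ring_bracket]
  simp

theorem pbwRep_apply_mon_zero (b : Module.Basis I P E) (x : E) (i : I) :
    pbwRep b x (mon P 0) {i} = b.repr x i := by
  refine basis_induction b (p := fun x => pbwRep b x (mon P 0) {i} = b.repr x i) (fun j => ?_)
    (by simp) (fun x y hx hy => by simp [hx, hy]) (fun a x hx => by simp [hx]) x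
  classical
  rw [pbwRep_of_le b (by simp)]
  simp [Finsupp.single_apply]

end PBW

/-! ### Monomial subspaces under the action. -/

section PBWSubmodules

variable {P : Type*} [Field P] {E : Type*} [LieRing E] [LieAlgebra P E] {I : Type*}

theorem mem_span_basis_image_univ (b : Module.Basis I P E) (x : E) :
    x ∈ Submodule.span P (b '' Set.univ) := by simp

/-- The span of the monomials that involve a variable from `A`. -/
abbrev meetSpan (P : Type*) [Field P] {I : Type*} (A : Set I) : Submodule P (Multiset I →₀ P) :=
  monSpan P {s | ∃ k ∈ s, k ∈ A}

/-- The span of the monomials of degree at least two that involve a variable from `A`. -/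
abbrev meetSpanTwo (P : Type*) [Field P] {I : Type*} (A : Set I) :
    Submodule P (Multiset I →₀ P) :=
  monSpan P {s | (∃ k ∈ s, k ∈ A) ∧ 2 ≤ s.card}

theorem meetSpanTwo_le (A : Set I) : meetSpanTwo P A ≤ meetSpan P A :=
  Finsupp.supported_mono fun _ h => h.1

variable [LinearOrder I]

theorem pbwRep_mem {b : Module.Basis I P E} {A : Set I} {B : Set (Multiset I)}
    {W : Submodule P (Multiset I →₀ P)}
    (h : ∀ i ∈ A, ∀ s ∈ B, pbwRep b (b i) (mon P s) ∈ W) {x : E}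
    (hx : x ∈ Submodule.span P (b '' A)) {w : Multiset I →₀ P} (hw : w ∈ monSpan P B) :
    pbwRep b x w ∈ W :=
  monSpan_le (W := W.comap (pbwRep b x))
    (fun s hs => mem_of_basis_span (T := LinearMap.flip (pbwRep b).toLinearMap (mon P s))
      (fun i hi => h i hi s hs) hx) hw

/-- Moving `b i` past the least variable `z_j` of a monomial. -/
theorem pbwRep_cons (b : Module.Basis I P E) {i j : I} {t : Multiset I} (hj : ∀ k ∈ t, j ≤ k) :
    pbwRep b (b i) (mon P (j ::ₘ t)) =
      pbwRep b (b j) (pbwRep b (b i) (mon P t)) + pbwRep b ⁅b i, b j⁆ (mon P t) := by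
  rw [← pbwRep_of_le b hj, pbwRep_comm]

/-- The variant of `pbwRep_cons` that separates the leading monomial. -/
theorem pbwRep_cons_of_lt (b : Module.Basis I P E) {i j : I} {t : Multiset I}
    (hj : ∀ k ∈ t, j ≤ k) (hji : j < i) :
    pbwRep b (b i) (mon P (j ::ₘ t)) = mon P (j ::ₘ i ::ₘ t) +
      pbwRep b (b j) (pbwRep b (b i) (mon P t) - mon P (i ::ₘ t)) +
        pbwRep b ⁅b i, b j⁆ (mon P t) := by
  have hle : ∀ k ∈ i ::ₘ t, j ≤ k := by
    intro k hk
    rcases Multiset.mem_cons.1 hk with rfl | hk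
    · exact hji.le
    · exact hj k hk
  rw [pbwRep_cons b hj, map_sub, pbwRep_of_le b hle]
  abel

/-- Reordering replaces b_i only by smaller basis elements, still in `A`, or by brackets inside the
subalgebra. -/
theorem pbwRep_mem_meetSpan_of_lower {b : Module.Basis I P E} {A : Set I} (hA : IsLowerSet A)
    (hlie : ∀ i ∈ A, ∀ j ∈ A, ⁅b i, b j⁆ ∈ Submodule.span P (b '' A)) {x : E}
    (hx : x ∈ Submodule.span P (b '' A)) (w : Multiset I →₀ P) :
    pbwRep b x w ∈ meetSpan P A := by
  refine pbwRep_mem (B := Set.univ) (fun i hi s _ => ?_) hx (by simp [monSpan])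
  induction hn : s.card using Nat.strong_induction_on generalizing i s with
  | _ n ih =>
  subst hn
  rcases le_or_exists_min_cons i s with hs | ⟨j, t, rfl, hj, hji⟩
  · rw [pbwRep_of_le b hs]
    exact mon_mem_monSpan ⟨i, by simp, hi⟩
  have hjA : j ∈ A := hA hji.le hi
  have ih' : ∀ k ∈ A, ∀ r ∈ {r : Multiset I | r.card ≤ t.card},
      pbwRep b (b k) (mon P r) ∈ meetSpan P A := fun k hk r hr =>
    ih r.card (by rw [Multiset.card_cons]; exact Nat.lt_succ_of_le hr) k hk r trivial rfl
  rw [pbwRep_cons_of_lt b hj hji]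
  refine add_mem (add_mem (mon_mem_monSpan ⟨j, by simp, hjA⟩) ?_) ?_
  · exact pbwRep_mem ih' (Submodule.subset_span ⟨j, hjA, rfl⟩) (pbwRep_sub_mem b i t)
  · exact pbwRep_mem ih' (hlie i hi j hjA) (mon_mem_monSpan (le_refl t.card))

/-- Only a bracket with the last remaining variable could lower the degree to one. That variable and
b_i then both belong to the abelian part, so the bracket is zero. -/
theorem pbwRep_mem_meetSpanTwo {b : Module.Basis I P E} {A : Set I} (hA : IsUpperSet A)
    (habel : ∀ i ∈ A, ∀ j ∈ A, ⁅b i, b j⁆ = 0) (x : E) {w : Multiset I →₀ P}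
    (hw : w ∈ meetSpan P A) : pbwRep b x w ∈ meetSpanTwo P A := by
  refine pbwRep_mem (A := Set.univ) (fun i _ s hs => ?_) (mem_span_basis_image_univ b x) hw
  induction hn : s.card using Nat.strong_induction_on generalizing i s with
  | _ n ih =>
  subst hn
  rcases le_or_exists_min_cons i s with his | ⟨j, t, rfl, hj, hji⟩
  · rw [pbwRep_of_le b his]
    obtain ⟨k, hk, hkA⟩ := hs
    have := Multiset.card_pos_iff_exists_mem.2 ⟨k, hk⟩
    exact mon_mem_monSpan ⟨⟨k, by simp [hk], hkA⟩, by rw [Multiset.card_cons]; omega⟩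
  by_cases ht : ∃ k ∈ t, k ∈ A
  · have ih' : ∀ k ∈ Set.univ, ∀ r ∈ {r : Multiset I | (∃ k ∈ r, k ∈ A) ∧ 2 ≤ r.card} ∩
        {r | r.card ≤ t.card}, pbwRep b (b k) (mon P r) ∈ meetSpanTwo P A := fun k _ r hr =>
      ih r.card (by rw [Multiset.card_cons]; exact Nat.lt_succ_of_le hr.2) k trivial r hr.1.1 rfl
    have iht : ∀ k ∈ Set.univ, ∀ r ∈ ({t} : Set (Multiset I)),
        pbwRep b (b k) (mon P r) ∈ meetSpanTwo P A := by
      rintro k _ r rfl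
      exact ih r.card (by simp) k trivial r ht rfl
    obtain ⟨k, hk, hkA⟩ := ht
    have htcard := Multiset.card_pos_iff_exists_mem.2 ⟨k, hk⟩
    have hcons : mon P (i ::ₘ t) ∈ meetSpanTwo P A :=
      mon_mem_monSpan ⟨⟨k, by simp [hk], hkA⟩, by rw [Multiset.card_cons]; omega⟩
    rw [pbwRep_cons_of_lt b hj hji]
    refine add_mem (add_mem (mon_mem_monSpan ⟨⟨k, by simp [hk], hkA⟩, by simp⟩) ?_) ?_
    · refine pbwRep_mem ih' (mem_span_basis_image_univ b _) ?_
      rw [monSpan, Finsupp.supported_inter]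
      exact ⟨sub_mem (iht i trivial t rfl) hcons, pbwRep_sub_mem b i t⟩
    · exact pbwRep_mem iht (mem_span_basis_image_univ b _) (mon_mem_monSpan rfl)
  · have hjA : j ∈ A := by
      obtain ⟨k, hk, hkA⟩ := hs
      rcases Multiset.mem_cons.1 hk with rfl | hk
      · exact hkA
      · exact absurd ⟨k, hk, hkA⟩ ht
    -- All variables of `t` are at least j, hence in the upper set `A`, yet `t` has none there.
    have ht0 : t = 0 := Multiset.eq_zero_of_forall_notMem fun k hk =>
      ht ⟨k, hk, hA (hj k hk) hjA⟩
    subst ht0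
    rw [pbwRep_cons_of_lt b hj hji, habel i (hA hji.le hjA) j hjA,
      pbwRep_of_le b (by simp)]
    simpa using mon_mem_monSpan (P := P)
      (show j ::ₘ i ::ₘ 0 ∈ {s : Multiset I | (∃ k ∈ s, k ∈ A) ∧ 2 ≤ s.card} from
        ⟨⟨j, by simp, hjA⟩, by simp⟩)

theorem pbwRep_mem_meetSpan_of_upper {b : Module.Basis I P E} {A : Set I} (hA : IsUpperSet A)
    (hlie : ∀ i ∈ A, ∀ j, ⁅b i, b j⁆ ∈ Submodule.span P (b '' A))
    (habel : ∀ i ∈ A, ∀ j ∈ A, ⁅b i, b j⁆ = 0) {x : E}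
    (hx : x ∈ Submodule.span P (b '' A)) (w : Multiset I →₀ P) :
    pbwRep b x w ∈ meetSpan P A := by
  refine pbwRep_mem (B := Set.univ) (fun i hi s _ => ?_) hx (by simp [monSpan])
  induction hn : s.card using Nat.strong_induction_on generalizing i s with
  | _ n ih =>
  subst hn
  rcases le_or_exists_min_cons i s with hs | ⟨j, t, rfl, hj, hji⟩
  · rw [pbwRep_of_le b hs]
    exact mon_mem_monSpan ⟨i, by simp, hi⟩
  have ih' : ∀ k ∈ A, ∀ r ∈ ({t} : Set (Multiset I)), pbwRep b (b k) (mon P r) ∈ meetSpan P A := by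
    rintro k hk r rfl
    exact ih r.card (by simp) k hk r trivial rfl
  rw [pbwRep_cons b hj]
  exact add_mem (meetSpanTwo_le A (pbwRep_mem_meetSpanTwo hA habel _ (ih' i hi t rfl)))
    (pbwRep_mem ih' (hlie i hi j) (mon_mem_monSpan rfl))

/-- For i outside `A`, the monomial z_i occurs in neither summand, and its coefficient is the i-th
coordinate of x. -/
theorem mem_span_of_pbwRep_mem {b : Module.Basis I P E} {A B : Set I} {x : E}
    (h : pbwRep b x (mon P 0) ∈ meetSpan P A ⊔ meetSpanTwo P B) :
    x ∈ Submodule.span P (b '' A) := by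
  rw [Module.Basis.mem_span_image]
  intro i hi
  by_contra hiA
  rw [Finset.mem_coe, Finsupp.mem_support_iff, ← pbwRep_apply_mon_zero] at hi
  obtain ⟨f, hf, g, hg, hfg⟩ := Submodule.mem_sup.1 h
  have hf0 : f {i} = 0 := (Finsupp.mem_supported' P f).1 hf {i} (by simpa using hiA)
  have hg0 : g {i} = 0 := (Finsupp.mem_supported' P g).1 hg {i} (by simp)
  rw [← hfg, Finsupp.add_apply, hf0, hg0, add_zero] at hi
  exact hi rfl

end PBWSubmodules

-- Bases adapted to two subspaces.

universe u

/-- A basis adapted to two disjoint subspaces, ordered so that the first subspace comes first and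
the second one last. -/
theorem exists_ordered_basis {P : Type*} [Field P] {E : Type u} [AddCommGroup E] [Module P E]
    {S M : Submodule P E} (h : Disjoint S M) :
    ∃ (I : Type u) (_ : LinearOrder I) (b : Module.Basis I P E) (A B : Set I),
      IsLowerSet A ∧ IsUpperSet B ∧ Submodule.span P (b '' A) = S ∧
        Submodule.span P (b '' B) = M := by
  classical
  obtain ⟨C, hC⟩ := Submodule.exists_isCompl (S ⊔ M)
  let bS := Module.Basis.ofVectorSpace P S
  let bC := Module.Basis.ofVectorSpace P C
  let bM := Module.Basis.ofVectorSpace P M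
  have hrange : ∀ (T : Submodule P E),
      Submodule.span P (Set.range (T.subtype ∘ Module.Basis.ofVectorSpace P T)) = T := by
    intro T
    rw [Set.range_comp, ← Submodule.map_span, Module.Basis.span_eq, Submodule.map_subtype_top]
  have hind : ∀ (T : Submodule P E),
      LinearIndependent P (T.subtype ∘ Module.Basis.ofVectorSpace P T) := fun T =>
    (Module.Basis.linearIndependent _).map' T.subtype T.ker_subtype
  have hCM : Disjoint C M := hC.disjoint.symm.mono_right le_sup_right
  have hSCM : Disjoint S (C ⊔ M) := by
    rw [sup_comm]
    exact h.disjoint_sup_right_of_disjoint_sup_left hC.disjoint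
  have hli := (hind S).sum_type ((hind C).sum_type (hind M) (by rwa [hrange, hrange]))
    (by rwa [Set.Sum.elim_range, Submodule.span_union, hrange, hrange, hrange])
  have hsp : ⊤ ≤ Submodule.span P (Set.range (Sum.elim (S.subtype ∘ bS)
      (Sum.elim (C.subtype ∘ bC) (M.subtype ∘ bM)))) := by
    rw [Set.Sum.elim_range, Set.Sum.elim_range, Submodule.span_union, Submodule.span_union, hrange,
      hrange, hrange, sup_comm C, ← sup_assoc, hC.sup_eq_top]
  let b := Module.Basis.mk hli hsp
  let e := (Equiv.sumCongr (Equiv.refl (Module.Basis.ofVectorSpaceIndex P S))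
    (toLex : Module.Basis.ofVectorSpaceIndex P C ⊕ Module.Basis.ofVectorSpaceIndex P M ≃ _)).trans
      toLex
  let o1 : LinearOrder (Module.Basis.ofVectorSpaceIndex P S) := linearOrderOfSTO WellOrderingRel
  let o2 : LinearOrder (Module.Basis.ofVectorSpaceIndex P C) := linearOrderOfSTO WellOrderingRel
  let o3 : LinearOrder (Module.Basis.ofVectorSpaceIndex P M) := linearOrderOfSTO WellOrderingRel
  have hval : ∀ k, b.reindex e (e k) = Sum.elim (S.subtype ∘ bS)
      (Sum.elim (C.subtype ∘ bC) (M.subtype ∘ bM)) k := fun k => by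
    rw [Module.Basis.reindex_apply, Equiv.symm_apply_apply, Module.Basis.mk_apply]
  refine ⟨_, inferInstance, b.reindex e, Set.range (e ∘ Sum.inl),
    Set.range (e ∘ Sum.inr ∘ Sum.inr), ?_, ?_, ?_, ?_⟩
  · rintro x y hyx ⟨i, rfl⟩
    obtain ⟨y | y, rfl⟩ := e.surjective y
    · exact ⟨y, rfl⟩
    · exact absurd hyx Sum.Lex.not_inr_le_inl
  · rintro x y hxy ⟨i, rfl⟩
    obtain ⟨y | y | y, rfl⟩ := e.surjective y
    · exact absurd hxy Sum.Lex.not_inr_le_inl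
    · exact absurd (Sum.Lex.inr_le_inr_iff.1 hxy) Sum.Lex.not_inr_le_inl
    · exact ⟨y, rfl⟩
  · rw [← Set.range_comp]
    refine Eq.trans ?_ (hrange S)
    congr 2
    funext i
    exact hval _
  · rw [← Set.range_comp]
    refine Eq.trans ?_ (hrange M)
    congr 2
    funext i
    exact hval _

/-! ### Fox derivatives of Lie elements and the easy direction. -/

variable {P : Type*} [Field P] {J : Type*}

theorem toU_lie (x y : FreeLieAlgebra P J) :
    toU P ⁅x, y⁆ = toU P x * toU P y - toU P y * toU P x := by
  simp only [toU, LieHom.coe_toLinearMap, LieHom.map_lie, LieRing.of_associative_ring_bracket]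

theorem foxD_mul (k : J) (u w : U P J) :
    foxD P k (u * w) = foxD P k u * w + aug P u • foxD P k w := by
  induction u using U_induction P with
  | h1 => simp [foxD_one]
  | hg j u hu =>
    classical
    rw [mul_assoc, foxD_gU_mul, foxD_gU_mul, map_mul, gU, aug_toU]
    split_ifs <;> simp
  | hadd u v hu hv => simp only [add_mul, map_add, hu, hv, add_smul]; abel
  | hsmul a u hu => simp only [smul_mul_assoc, map_smul, hu, smul_add, smul_assoc]

theorem foxD_toU_lie (k : J) (x y : FreeLieAlgebra P J) :
    foxD P k (toU P ⁅x, y⁆) =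
      foxD P k (toU P x) * toU P y - foxD P k (toU P y) * toU P x := by
  simp [toU_lie, foxD_mul, aug_toU]

theorem foxD_toU_of_mem_subalg {K : Set J} {k : J} (hk : k ∉ K) {x : FreeLieAlgebra P J}
    (hx : x ∈ subalg P K) : foxD P k (toU P x) = 0 := by
  classical
  induction hx using LieSubalgebra.lieSpan_induction with
  | mem x hx =>
    obtain ⟨j, hj, rfl⟩ := hx
    have h := foxD_gU_mul P k j 1
    rw [mul_one, if_neg (by rintro rfl; exact hk hj)] at h
    exact h
  | zero => simp
  | smul a x hx ih => simp [ih]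
  | add x y hx hy ihx ihy => simp [ihx, ihy]
  | lie x y hx hy ihx ihy => simp [foxD_toU_lie, ihx, ihy]

theorem toU_mem_idealU {N : LieIdeal P (FreeLieAlgebra P J)} {x : FreeLieAlgebra P J}
    (hx : x ∈ N) : toU P x ∈ idealU P N :=
  TwoSidedIdeal.subset_span ⟨x, hx, rfl⟩

/-- The ideal of those `x ∈ N` whose `k`-th Fox derivative lies in `N_U`. -/
def foxIdeal (N : LieIdeal P (FreeLieAlgebra P J)) (k : J) : LieIdeal P (FreeLieAlgebra P J) where
  carrier := {x | x ∈ N ∧ foxD P k (toU P x) ∈ idealU P N}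
  zero_mem' := ⟨zero_mem _, by simp [zero_mem]⟩
  add_mem' hx hy := ⟨add_mem hx.1 hy.1, by rw [map_add, map_add]; exact add_mem hx.2 hy.2⟩
  smul_mem' a x hx := ⟨N.smul_mem a hx.1, by
    rw [map_smul, map_smul, Algebra.smul_def]
    exact (idealU P N).mul_mem_left _ _ hx.2⟩
  -- D_k[y, x] = D_k(y) x − D_k(x) y; the first term lies in N_U only because x is required to be in
  -- N.
  lie_mem {y x} hx := ⟨N.lie_mem hx.1, by
    rw [foxD_toU_lie]
    exact sub_mem ((idealU P N).mul_mem_left _ _ (toU_mem_idealU hx.1))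
      ((idealU P N).mul_mem_right _ _ hx.2)⟩

theorem idealKN_le_foxIdeal {K : Set J} (N : LieIdeal P (FreeLieAlgebra P J)) {k : J}
    (hk : k ∉ K) : idealKN P K N ≤ foxIdeal N k := by
  refine LieSubmodule.lieSpan_le.2 fun x hx => ⟨hx.2, ?_⟩
  rw [foxD_toU_of_mem_subalg hk hx.1]
  exact zero_mem _

theorem lie_self_le_foxIdeal (N : LieIdeal P (FreeLieAlgebra P J)) (k : J) :
    ⁅N, N⁆ ≤ foxIdeal N k := by
  refine (LieSubmodule.lie_le_iff _ _ _).2 fun x hx y hy => ⟨N.lie_mem hy, ?_⟩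
  rw [foxD_toU_lie]
  exact sub_mem ((idealU P N).mul_mem_left _ _ (toU_mem_idealU hy))
    ((idealU P N).mul_mem_left _ _ (toU_mem_idealU hx))

theorem idealKN_le (K : Set J) (N : LieIdeal P (FreeLieAlgebra P J)) : idealKN P K N ≤ N :=
  LieSubmodule.lieSpan_le.2 fun _ hx => hx.2

/-! ### From Fox derivatives to the decomposition. -/

section Representation

variable {V : Type*} [AddCommGroup V] [Module P V]
  (ρ : FreeLieAlgebra P J →ₗ⁅P⁆ Module.End P V)

theorem lift_toU (x : FreeLieAlgebra P J) :
    UniversalEnvelopingAlgebra.lift P ρ (toU P x) = ρ x :=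
  UniversalEnvelopingAlgebra.lift_ι_apply P ρ x

/-- If `W` is stable under `F` and contains the image of `N`, then it contains that of `N_U`. -/
theorem lift_mem_of_mem_idealU {N : LieIdeal P (FreeLieAlgebra P J)} {W : Submodule P V}
    (hW : ∀ x, ∀ w ∈ W, ρ x w ∈ W) (hN : ∀ x ∈ N, ∀ w, ρ x w ∈ W) {u : U P J}
    (hu : u ∈ idealU P N) (w : V) : UniversalEnvelopingAlgebra.lift P ρ u w ∈ W := by
  have hstab : ∀ (u : U P J), ∀ w ∈ W, UniversalEnvelopingAlgebra.lift P ρ u w ∈ W := by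
    intro u
    induction u using U_induction P with
    | h1 => intro w hw; simpa using hw
    | hg j u hu => intro w hw; rw [map_mul, gU, lift_toU]; exact hW _ _ (hu w hw)
    | hadd u v hu hv => intro w hw; rw [map_add]; exact add_mem (hu w hw) (hv w hw)
    | hsmul a u hu => intro w hw; rw [map_smul]; exact W.smul_mem a (hu w hw)
  let T : TwoSidedIdeal (U P J) := TwoSidedIdeal.mk'
    {u | ∀ w, UniversalEnvelopingAlgebra.lift P ρ u w ∈ W} (by simp)
    (fun {x y} hx hy w => by rw [map_add]; exact add_mem (hx w) (hy w))
    (fun {x} hx w => by rw [map_neg]; exact neg_mem (hx w))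
    (fun {x y} hy w => by rw [map_mul]; exact hstab x _ (hy w))
    (fun {x y} hx w => by rw [map_mul]; exact hx _)
  have hle : idealU P N ≤ T := by
    refine TwoSidedIdeal.span_le.2 ?_
    rintro _ ⟨x, hx, rfl⟩
    rw [SetLike.mem_coe, TwoSidedIdeal.mem_mk']
    intro w
    rw [lift_toU]
    exact hN x hx w
  have := hle hu
  rw [TwoSidedIdeal.mem_mk'] at this
  exact this w

/-- The value of a representation on `v` from the Fox derivatives of `v`. -/
theorem rep_apply_mem_of_foxD {K : Set J} {N : LieIdeal P (FreeLieAlgebra P J)}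
    {W₁ W₂ W₃ : Submodule P V} (h₁ : ∀ j ∈ K, ∀ w, ρ (FreeLieAlgebra.of P j) w ∈ W₁)
    (hN : ∀ x ∈ N, ∀ w, ρ x w ∈ W₂) (h₃ : ∀ x, ∀ w ∈ W₂, ρ x w ∈ W₃) (h₃₂ : W₃ ≤ W₂)
    {v : FreeLieAlgebra P J} (hv : ∀ k ∉ K, foxD P k (toU P v) ∈ idealU P N) (w : V) :
    ρ v w ∈ W₁ ⊔ W₃ := by
  obtain ⟨d, hd, hsum⟩ := foxD_sum P (toU P v)
  rw [aug_toU, map_zero, zero_add] at hsum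
  rw [← lift_toU, hsum, Finsupp.sum, map_sum, LinearMap.sum_apply]
  refine sum_mem fun j _ => ?_
  rw [map_mul, gU, lift_toU, Module.End.mul_apply]
  by_cases hj : j ∈ K
  · exact Submodule.mem_sup_left (h₁ j hj _)
  · refine Submodule.mem_sup_right (h₃ _ _ ?_)
    rw [hd]
    exact lift_mem_of_mem_idealU ρ (fun x w hw => h₃₂ (h₃ x w hw)) hN (hv j hj) w

end Representation

/-- If `S` is a subalgebra and `M` an abelian ideal of `E` with `S ∩ M = 0`, then a homomorphism
`F → E` that maps `F_K` into `S` and `N` into `M` maps `v` into `S`, provided that the Fox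
derivatives of `v` outside `K` lie in `N_U`. -/
theorem map_mem_of_foxD {E : Type*} [LieRing E] [LieAlgebra P E] (q : FreeLieAlgebra P J →ₗ⁅P⁆ E)
    {K : Set J} {N : LieIdeal P (FreeLieAlgebra P J)} (S : LieSubalgebra P E) (M : LieIdeal P E)
    (hM : ∀ x ∈ M, ∀ y ∈ M, ⁅x, y⁆ = 0) (hSM : Disjoint S.toSubmodule M.toSubmodule)
    (hK : ∀ j ∈ K, q (FreeLieAlgebra.of P j) ∈ S) (hN : ∀ x ∈ N, q x ∈ M)
    {v : FreeLieAlgebra P J} (hv : ∀ k ∉ K, foxD P k (toU P v) ∈ idealU P N) : q v ∈ S := by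
  obtain ⟨I, _, b, A, B, hA, hB, hAS, hBM⟩ := exists_ordered_basis hSM
  have memA : ∀ i ∈ A, b i ∈ S := fun i hi => by
    have : b i ∈ S.toSubmodule := hAS ▸ Submodule.subset_span ⟨i, hi, rfl⟩
    exact this
  have memB : ∀ i ∈ B, b i ∈ M := fun i hi => by
    have : b i ∈ M.toSubmodule := hBM ▸ Submodule.subset_span ⟨i, hi, rfl⟩
    exact this
  have hlieA : ∀ i ∈ A, ∀ j ∈ A, ⁅b i, b j⁆ ∈ Submodule.span P (b '' A) := fun i hi j hj => by
    rw [hAS]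
    exact S.lie_mem (memA i hi) (memA j hj)
  have hlieB : ∀ i ∈ B, ∀ j, ⁅b i, b j⁆ ∈ Submodule.span P (b '' B) := fun i hi j => by
    rw [hBM]
    exact lie_mem_left P E M _ _ (memB i hi)
  have habel : ∀ i ∈ B, ∀ j ∈ B, ⁅b i, b j⁆ = 0 := fun i hi j hj =>
    hM _ (memB i hi) _ (memB j hj)
  have h₁ : ∀ j ∈ K, ∀ w, pbwRep b (q (FreeLieAlgebra.of P j)) w ∈ meetSpan P A := fun j hj =>
    pbwRep_mem_meetSpan_of_lower hA hlieA (by rw [hAS]; exact hK j hj)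
  have h₂ : ∀ x ∈ N, ∀ w, pbwRep b (q x) w ∈ meetSpan P B := fun x hx =>
    pbwRep_mem_meetSpan_of_upper hB hlieB habel (by rw [hBM]; exact hN x hx)
  have h₃ : ∀ x, ∀ w ∈ meetSpan P B, pbwRep b (q x) w ∈ meetSpanTwo P B := fun x _ hw =>
    pbwRep_mem_meetSpanTwo hB habel (q x) hw
  have h : pbwRep b (q v) (mon P 0) ∈ meetSpan P A ⊔ meetSpanTwo P B :=
    rep_apply_mem_of_foxD ((pbwRep b).comp q) h₁ h₂ h₃ (meetSpanTwo_le B) hv (mon P 0)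
  have hspan := mem_span_of_pbwRep_mem h
  rw [hAS] at hspan
  exact hspan

theorem exists_decomposition_of_foxD {K : Set J} {N : LieIdeal P (FreeLieAlgebra P J)}
    {v : FreeLieAlgebra P J} (hv : ∀ k ∉ K, foxD P k (toU P v) ∈ idealU P N) :
    ∃ v₀ ∈ subalg P K, ∃ v₁ ∈ idealKN P K N, v - (v₀ + v₁) ∈ ⁅N, N⁆ := by
  -- Exactly what must vanish for N to become abelian and for the images of F_K and N to become
  -- disjoint.
  let R : LieIdeal P (FreeLieAlgebra P J) := idealKN P K N ⊔ ⁅N, N⁆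
  have hRN : R ≤ N := sup_le (idealKN_le K N) (LieSubmodule.lie_le_right N N)
  let q : FreeLieAlgebra P J →ₗ⁅P⁆ FreeLieAlgebra P J ⧸ R :=
    { R.toSubmodule.mkQ with map_lie' := rfl }
  have hq : ∀ x, q x = 0 ↔ x ∈ R := fun x => LieSubmodule.Quotient.mk_eq_zero R
  have hqs : Function.Surjective q := LieSubmodule.Quotient.surjective_mk' R
  have hmap : ∀ y, y ∈ N.map q ↔ ∃ x ∈ N, q x = y := fun y => by
    rw [← LieSubmodule.mem_toSubmodule, LieIdeal.coe_map_of_surjective hqs]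
    exact Submodule.mem_map
  have hS : q v ∈ (subalg P K).map q := by
    refine map_mem_of_foxD q _ (N.map q) ?_ ?_ ?_ ?_ hv
    · intro x hx y hy
      obtain ⟨x, hxN, rfl⟩ := (hmap x).1 hx
      obtain ⟨y, hyN, rfl⟩ := (hmap y).1 hy
      rw [← LieHom.map_lie, hq]
      exact (le_sup_right : _ ≤ R) (LieSubmodule.lie_mem_lie hxN hyN)
    · rw [Submodule.disjoint_def]
      rintro _ ⟨x, hx, rfl⟩ hy
      obtain ⟨y, hy, hxy⟩ := (hmap _).1 hy
      have hxyR : y - x ∈ R := by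
        rw [← hq, map_sub, sub_eq_zero]
        exact hxy
      -- As R lies in N, an element of F_K that agrees with an element of N modulo R is itself in N.
      have hxN : x ∈ N := by
        have := sub_mem hy (hRN hxyR)
        rwa [sub_sub_cancel] at this
      exact (hq x).2 ((le_sup_left : _ ≤ R) (LieSubmodule.subset_lieSpan ⟨hx, hxN⟩))
    · exact fun j hj => ⟨_, LieSubalgebra.subset_lieSpan ⟨j, hj, rfl⟩, rfl⟩
    · exact fun x hx => (hmap _).2 ⟨x, hx, rfl⟩
  obtain ⟨v₀, hv₀, h⟩ := hS
  have hR : v - v₀ ∈ R := by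
    rw [← hq, map_sub, sub_eq_zero]
    exact h.symm
  obtain ⟨v₁, hv₁, w, hw, hsum⟩ := (LieSubmodule.mem_sup _ _ _).1 hR
  refine ⟨v₀, hv₀, v₁, hv₁, ?_⟩
  rwa [← sub_sub, ← hsum, add_sub_cancel_left]

end FoxLie

end

theorem mainTheorem3 (P : Type*) [Field P] (J : Type*) (N : LieIdeal P (FreeLieAlgebra P J))
    (K : Set J) (v : FreeLieAlgebra P J) :
    (∀ k : J, k ∉ K → FoxLie.foxD P k (FoxLie.toU P v) ∈ FoxLie.idealU P N) ↔
      ∃ v₀ ∈ FoxLie.subalg P K, ∃ v₁ ∈ FoxLie.idealKN P K N, v - (v₀ + v₁) ∈ ⁅N, N⁆ := by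
  refine ⟨FoxLie.exists_decomposition_of_foxD, ?_⟩
  rintro ⟨v₀, hv₀, v₁, hv₁, h⟩ k hk
  have hv : v = v₀ + (v₁ + (v - (v₀ + v₁))) := by abel
  rw [hv, map_add, map_add, FoxLie.foxD_toU_of_mem_subalg hk hv₀, zero_add]
  exact (add_mem (FoxLie.idealKN_le_foxIdeal N hk hv₁) (FoxLie.lie_self_le_foxIdeal N k h)).2
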